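/- All Hilbert spaces are finite-dimensional; a sub-normalized state is a positive semidefinite operator of trace at most $1$ (a normalized state has trace $1$), and logarithms are to base $2$. Let $\mathcal H_A$ be an $n$-qubit space with bit basis $|z\rangle$ and phase basis $|\widetilde x\rangle=2^{-n/2}\sum_{z}(-1)^{x\cdot z}|z\rangle$, $x,z\in\{0,1\}^n$. **Definitions.** * The conditional min-entropy $H_{\min}(\rho_{AE}|E)$ is the largest real $\lambda$ with $2^{-\lambda}\,\mathbb I_A\otimes\sigma_E\ge\rho_{AE}$ for some normalized state $\sigma_E$ (it is $+\infty$ if $\rho_{AE}=0$). The smooth one, $H^{\varepsilon}_{\min}(\rho_{AE}|E)$, is the largest $H_{\min}(\bar\rho_{AE}|E)$ over sub-normalized $\bar\rho_{AE}$ with $P(\bar\rho_{AE},\rho_{AE})\le\varepsilon$, where $P=\sqrt{1-F^2}$ and $F(\rho,\tau)=\|\sqrt\rho\sqrt\tau\|_1+\sqrt{(1-\mathrm{Tr}\rho)(1-\mathrm{Tr}\tau)}$. * The Rényi entropy of degree $1/2$ of a (sub-normalized) distribution is $H_{1/2}(X)=2\log\sum_x\Pr(X=x)^{1/2}$ ($-\infty$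 if the distribution is zero). * A pure sub-normalized state $|\Phi\rangle_{AE\bar A}$ is a semi-purification of $\rho_{AE}$ if $\rho_{AE}=\sum_z|z\rangle\langle z|_A\,\mathrm{Tr}_{\bar A}(|\Phi\rangle\langle\Phi|)\,|z\rangle\langle z|_A$. Its phase distribution is $\Pr(X=x)=\langle\widetilde x|\Phi_A|\widetilde x\rangle$, where $\Phi_A=\mathrm{Tr}_{E\bar A}|\Phi\rangle\langle\Phi|$. * Actual QKD scheme: Alice, Eve and Bob hold a normalized state $\rho^{\rm ini}_{A'EB'}$. A sample measurement is made, its public announcements being written into $\mathcal H_E$, and the protocol continues only on a set of accepted outcomes. Then Alice measures $\mathcal H_{A'}$ and Bob measures $\mathcal H_{B'}$ to obtain sifted keys $a,b\in\{0,1\}^n$, stored in the bit basis. The resulting sub-normalized state, reduced to Alice's key and Eve's system, is $\rho^{\rm sif}_{AE}$. * Virtual scheme: $\rho^{\rm ini}$ is replaced by a purification. The sample measurement with outcome "continue" is rewritten as a unitary followed by a projection on a fresh ancilla. Alice's sifted-key measurement is rewritten as a unitary $U^{\rm sif}$ on $\mathcal H_A$ (initially $|0\rangle$) and $\mathcal H_{\bar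 A}$ followed by the bit-basis measurement of $\mathcal H_A$. Here $\mathcal H_{\bar A}$ collects all systems other than $\mathcal H_A$ and $\mathcal H_E$. The pure sub-normalized state after $U^{\rm sif}$, just before the bit-basis measurement, is $|\Psi^{\rm pre}\rangle_{AE\bar A}$. **Lemma.** Let $H^{\rm th}_{1/2}\in\mathbb R$. 1. For every actual scheme and every associated virtual scheme: if the phase distribution $X$ of $|\Psi^{\rm pre}\rangle$ satisfies $H_{1/2}(X)\le H_{1/2}^{\rm th}$ (assumption SM-PEC-Rényi), then $$H_{\min}(\rho^{\rm sif}_{AE}|E)\ \ge\ n-H^{\rm th}_{1/2}.$$ Moreover $H^{0}_{\min}(\rho^{\rm sif}_{AE}|E)\ge n-H^{\rm th}_{1/2}$, so that the scheme is of LHL type: it satisfies the assumption SM-LHL, $H^{\varepsilon}_{\min}(\rho^{\rm sif}_{AE}|E)\ge H^{\rm th}_{\min}$, with $\varepsilon=0$ and $H_{\min}^{\rm th}=n-H^{\rm th}_{1/2}$. 2. More generally, both inequalities hold for every sub-normalized classical-quantum state $\rho_{AE}$, with $\mathcal H_E\neq 0$, that has a semi-purification $|\Phi\rangle_{AE\bar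 A}$ whose phase distribution satisfies $H_{1/2}(X)\le H_{1/2}^{\rm th}$. -/

import Mathlib

open scoped Kronecker ComplexOrder MatrixOrder

noncomputable section

namespace QKD

/-- Bit strings of length `n`; this type indexes the bit basis of an `n`-qubit space. -/
abbrev BitString (n : ℕ) : Type := Fin n → ZMod 2

/-- Partial trace over the second tensor factor. -/
def ptrace {α β : Type*} [Fintype β] (M : Matrix (α × β) (α × β) ℂ) : Matrix α α ℂ :=
  Matrix.of fun i j => ∑ k, M (i, k) (j, k)

/-- The rank-one operator `|ψ⟩⟨ψ|`. -/
def pureOp {α : Type*} (ψ : α → ℂ) : Matrix α α ℂ :=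
  Matrix.vecMulVec ψ (star ψ)

/-- A sub-normalized state: a positive semidefinite operator of trace at most one. -/
def IsSubnormalized {α : Type*} [Fintype α] (ρ : Matrix α α ℂ) : Prop :=
  ρ.PosSemidef ∧ ρ.trace.re ≤ 1

/-- A normalized state: a positive semidefinite operator of trace one. -/
def IsNormalized {α : Type*} [Fintype α] (ρ : Matrix α α ℂ) : Prop :=
  ρ.PosSemidef ∧ ρ.trace = 1

/-! ### Entropies -/

/-- The conditional min-entropy `H_min(ρ_AE | E)`: the largest real `l` with
`2 ^ (-l) • (1_A ⊗ σ_E) ≥ ρ_AE` for some normalized state `σ_E`.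
It is extended-real valued, because all real `l` are admissible when `ρ_AE = 0`. -/
def condMinEntropy {α ε : Type*} [Fintype α] [DecidableEq α] [Fintype ε]
    (ρ : Matrix (α × ε) (α × ε) ℂ) : EReal :=
  sSup {h : EReal | ∃ l : ℝ, h = (l : EReal) ∧ ∃ σ : Matrix ε ε ℂ, IsNormalized σ ∧
    (((2 : ℝ) ^ (-l)) • ((1 : Matrix α α ℂ) ⊗ₖ σ) - ρ).PosSemidef}

/-- The 1-norm `‖M‖₁ = Tr √(M† M)`. -/
def norm1 {α : Type*} [Fintype α] [DecidableEq α] (M : Matrix α α ℂ) : ℝ :=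
  (CFC.sqrt (M.conjTranspose * M)).trace.re

/-- The generalized fidelity of sub-normalized states,
`F(ρ, τ) = ‖√ρ √τ‖₁ + √((1 - Tr ρ) (1 - Tr τ))`. -/
def fidelity {α : Type*} [Fintype α] [DecidableEq α] (ρ τ : Matrix α α ℂ) : ℝ :=
  norm1 (CFC.sqrt ρ * CFC.sqrt τ) + Real.sqrt ((1 - ρ.trace.re) * (1 - τ.trace.re))

/-- The purified distance `P(ρ, τ) = √(1 - F(ρ, τ) ^ 2)`. -/
def purifiedDistance {α : Type*} [Fintype α] [DecidableEq α] (ρ τ : Matrix α α ℂ) : ℝ :=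
  Real.sqrt (1 - fidelity ρ τ ^ 2)

/-- The smooth conditional min-entropy `H_min^δ(ρ_AE | E)`: the largest conditional min-entropy
of a sub-normalized state within purified distance `δ` of `ρ_AE`. -/
def smoothCondMinEntropy {α ε : Type*} [Fintype α] [DecidableEq α] [Fintype ε] [DecidableEq ε]
    (δ : ℝ) (ρ : Matrix (α × ε) (α × ε) ℂ) : EReal :=
  sSup {h : EReal | ∃ τ : Matrix (α × ε) (α × ε) ℂ,
    h = condMinEntropy τ ∧ IsSubnormalized τ ∧ purifiedDistance τ ρ ≤ δ}

/-- The Rényi entropy of degree `1/2`, in bits: `H_{1/2}(X) = 2 log₂ ∑ₓ Pr(X = x) ^ (1/2)`.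
It is `-∞` for the zero sub-distribution. -/
def renyiHalf {χ : Type*} [Fintype χ] (p : χ → ℝ) : EReal :=
  if ∑ x, Real.sqrt (p x) = 0 then ⊥
  else ((2 * Real.logb 2 (∑ x, Real.sqrt (p x)) : ℝ) : EReal)

/-! ### Bit basis, phase basis, semi-purifications -/

/-- The phase-basis vector `|x̃⟩ = 2 ^ (-n/2) ∑_z (-1) ^ (x · z) |z⟩`. -/
def phaseKet {n : ℕ} (x : BitString n) : BitString n → ℂ :=
  fun z => (((2 : ℝ) ^ (-(n : ℝ) / 2) : ℝ) : ℂ) * (-1) ^ (x ⬝ᵥ z).val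

/-- The distribution of the phase degrees of freedom of a vector in `H_A ⊗ H_E ⊗ H_Ā`:
`Pr(X = x) = ⟨x̃| ρ_A |x̃⟩`, where `ρ_A` is the reduced state on the `n`-qubit space `H_A`. -/
def phaseDist {n : ℕ} {ε κ : Type*} [Fintype ε] [Fintype κ]
    (Ψ : (BitString n × ε) × κ → ℂ) (x : BitString n) : ℝ :=
  (star (phaseKet x) ⬝ᵥ (ptrace (ptrace (pureOp Ψ))).mulVec (phaseKet x)).re

/-- The `Z`-basis measurement of `H_A`, without selecting the outcome:
`ρ_AE ↦ ∑_z |z⟩⟨z|_A ρ_AE |z⟩⟨z|_A`. -/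
def zMeasure {n : ℕ} {ε : Type*} [Fintype ε] [DecidableEq ε]
    (ρ : Matrix (BitString n × ε) (BitString n × ε) ℂ) :
    Matrix (BitString n × ε) (BitString n × ε) ℂ :=
  ∑ z : BitString n,
    (Matrix.single z z (1 : ℂ) ⊗ₖ (1 : Matrix ε ε ℂ)) * ρ *
      (Matrix.single z z (1 : ℂ) ⊗ₖ (1 : Matrix ε ε ℂ))

/-- The pure sub-normalized state `Φ` in `H_A ⊗ H_E ⊗ H_Ā` is a semi-purification of `ρ_AE`:
its reduced state on `H_A ⊗ H_E` becomes `ρ_AE` after the `Z`-basis measurement of `H_A`. -/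
def IsSemiPurification {n : ℕ} {ε κ : Type*} [Fintype ε] [DecidableEq ε] [Fintype κ]
    (Φ : (BitString n × ε) × κ → ℂ)
    (ρ : Matrix (BitString n × ε) (BitString n × ε) ℂ) : Prop :=
  IsSubnormalized (pureOp Φ) ∧ zMeasure (ptrace (pureOp Φ)) = ρ

/-! ### The actual scheme, up to the sifted key -/

/-- The part of a quantum key distribution scheme which determines the sifted key.
`A` and `B` index the spaces measured by Alice and by Bob, `E` that of Eve, and `I` the outcomes
of the sample measurement. -/
structure ActualScheme (n : ℕ) (A E B I : Type*) [Fintype A] [DecidableEq A]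
    [Fintype E] [DecidableEq E] [Fintype B] [DecidableEq B] [Fintype I] where
  /-- the initial mixed state -/
  init : Matrix (A × E × B) (A × E × B) ℂ
  init_normalized : IsNormalized init
  /-- The measurement operators of the sample measurement. They may act on `E`, since
  public announcements are written there. -/
  smp : I → Matrix (A × E × B) (A × E × B) ℂ
  smp_complete : ∑ i, (smp i).conjTranspose * smp i = 1
  /-- the outcomes of the sample measurement on which the protocol is continued -/
  pass : Finset I
  /-- the measurement operators by which Alice obtains her sifted key -/
  sifA : BitString n → Matrix A A ℂ
  sifA_complete : ∑ a, (sifA a).conjTranspose * sifA a = 1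
  /-- the measurement operators by which Bob obtains his sifted key -/
  sifB : BitString n → Matrix B B ℂ
  sifB_complete : ∑ b, (sifB b).conjTranspose * sifB b = 1

section Schemes

variable {n : ℕ} {A E B I C R : Type*} [Fintype A] [DecidableEq A] [Fintype E] [DecidableEq E]
  [Fintype B] [DecidableEq B] [Fintype I] [Fintype C] [DecidableEq C] [Fintype R] [DecidableEq R]

/-- The effect of the sample measurement when the protocol is continued (not normalized). -/
def ActualScheme.sample (S : ActualScheme n A E B I)
    (ρ : Matrix (A × E × B) (A × E × B) ℂ) : Matrix (A × E × B) (A × E × B) ℂ :=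
  ∑ i ∈ S.pass, S.smp i * ρ * (S.smp i).conjTranspose

/-- The sub-normalized state after the sifted key measurement, on
(Alice's key) ⊗ (Bob's key) ⊗ (measured systems of Alice, Eve and Bob). -/
def ActualScheme.sifted (S : ActualScheme n A E B I) :
    Matrix (BitString n × BitString n × A × E × B) (BitString n × BitString n × A × E × B) ℂ :=
  ∑ a : BitString n, ∑ b : BitString n,
    Matrix.single a a (1 : ℂ) ⊗ₖ (Matrix.single b b (1 : ℂ) ⊗ₖ
      ((S.sifA a ⊗ₖ ((1 : Matrix E E ℂ) ⊗ₖ S.sifB b)) * S.sample S.init *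
        (S.sifA a ⊗ₖ ((1 : Matrix E E ℂ) ⊗ₖ S.sifB b)).conjTranspose))

/-- The reduced sub-normalized sifted-key state of Alice's key and Eve's system. -/
def ActualScheme.siftedAE (S : ActualScheme n A E B I) :
    Matrix (BitString n × E) (BitString n × E) ℂ :=
  Matrix.of fun x y => ∑ b : BitString n, ∑ a' : A, ∑ b' : B,
    S.sifted (x.1, b, a', x.2, b') (y.1, b, a', y.2, b')

/-! ### The purified (virtual) scheme, up to the sifted key -/

/-- The data of the virtual scheme obtained from an actual scheme by purifying its initial state
with a space indexed by `C`, and by rewriting each measurement as a unitary operation, with a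
further ancilla indexed by `R`, followed by a projective measurement. All the systems except those
indexed by `BitString n` and by `E` form Alice's ancilla, which is indexed by `A × B × R × C`. -/
structure VirtualScheme (S : ActualScheme n A E B I) (C R : Type*) [Fintype C] [DecidableEq C]
    [Fintype R] [DecidableEq R] where
  /-- a purification of the initial state -/
  ini : (A × E × B) × C → ℂ
  ini_purifies : ptrace (pureOp ini) = S.init
  /-- the initial basis state of the ancilla `R` -/
  blank : R
  /-- the unitary operation and the projection which replace the sample measurement -/
  uSmp : Matrix ((A × E × B) × R) ((A × E × B) × R) ℂ
  uSmp_unitary : uSmp ∈ Matrix.unitaryGroup ((A × E × B) × R) ℂ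
  pSmp : Matrix R R ℂ
  pSmp_proj : pSmp.IsHermitian ∧ pSmp * pSmp = pSmp
  /-- Unitary and projection have the effect of the sample measurement with outcome `continue`. -/
  smp_eq : ∀ ρ : Matrix (A × E × B) (A × E × B) ℂ,
    ptrace ((((1 : Matrix (A × E × B) (A × E × B) ℂ) ⊗ₖ pSmp) * uSmp) *
      (ρ ⊗ₖ Matrix.single blank blank (1 : ℂ)) *
      (((1 : Matrix (A × E × B) (A × E × B) ℂ) ⊗ₖ pSmp) * uSmp).conjTranspose) = S.sample ρ
  /-- The unitary operation which, acting on the `n`-qubit space in the state `|0⟩` and on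
  Alice's ancilla, and followed by the `Z`-basis measurement, replaces the measurement of Alice's
  sifted key. -/
  uSif : Matrix (BitString n × A × B × R × C) (BitString n × A × B × R × C) ℂ
  uSif_unitary : uSif ∈ Matrix.unitaryGroup (BitString n × A × B × R × C) ℂ
  /-- The outcomes `a` have the same probabilities, in every state, as in Alice's measurement:
  the two measurements have the same positive operators. -/
  sif_eq : ∀ a : BitString n,
    (uSif.submatrix (fun k => (a, k)) (fun k => (0, k))).conjTranspose *
      uSif.submatrix (fun k => (a, k)) (fun k => (0, k)) =
    ((S.sifA a).conjTranspose * S.sifA a) ⊗ₖ (1 : Matrix (B × R × C) (B × R × C) ℂ)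

/-- The pure sub-normalized state after the sample measurement of the virtual scheme:
`P U (|ini⟩ ⊗ |blank⟩)`. -/
def VirtualScheme.smpState {S : ActualScheme n A E B I} (V : VirtualScheme S C R) :
    ((A × E × B) × R) × C → ℂ :=
  fun y => ∑ x : A × E × B,
    (((1 : Matrix (A × E × B) (A × E × B) ℂ) ⊗ₖ V.pSmp) * V.uSmp) y.1 (x, V.blank) *
      V.ini (x, y.2)

/-- The pure sub-normalized state after the sifted key state preparation of the virtual scheme,
just before the `Z`-basis measurement: the unitary `uSif` applied to `|0⟩ ⊗ |smpState⟩`. -/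
def VirtualScheme.preState {S : ActualScheme n A E B I} (V : VirtualScheme S C R) :
    (BitString n × E) × (A × B × R × C) → ℂ :=
  fun y => ∑ k : A × B × R × C,
    V.uSif (y.1.1, y.2) (0, k) * V.smpState (((k.1, y.1.2, k.2.1), k.2.2.1), k.2.2.2)

end Schemes

/-! ### The two assumptions -/

/-- The assumption of the phase-error-correction approach in terms of the Rényi entropy:
the phase distribution `X` of the state satisfies `H_{1/2}(X) ≤ Hth`. -/
def AssumptionSMPECRenyi {n : ℕ} {ε κ : Type*} [Fintype ε] [Fintype κ]
    (Ψ : (BitString n × ε) × κ → ℂ) (Hth : ℝ) : Prop :=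
  renyiHalf (phaseDist Ψ) ≤ (Hth : EReal)

/-- The assumption of the leftover-hashing approach: `H_min^δ(ρ_AE | E) ≥ Hth`. -/
def AssumptionSMLHL {n : ℕ} {ε : Type*} [Fintype ε] [DecidableEq ε]
    (ρ : Matrix (BitString n × ε) (BitString n × ε) ℂ) (δ Hth : ℝ) : Prop :=
  (Hth : EReal) ≤ smoothCondMinEntropy δ ρ

end QKD

end

noncomputable section

namespace QKD

open Matrix

/-! Regard `B_x = ⟨x̃|Φ` and `C_z = ⟨z|Φ` as operators from the ancilla to Eve's space. Then `p_x =
Tr (B_x B_x†)`, the measured state has blocks `C_z C_z†`, and `C_z = ∑ ⟨z|x̃⟩ B_x`. Cauchy-Schwarz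
with weights `√p_x` gives `C_z C_z† ≤ 2^(-n) (∑ √p_x) ∑ p_x^(-1/2) B_x B_x†`. Since `|⟨z|x̃⟩|² =
2^(-n)` for all `z`, the bound does not depend on `z`; its trace is `2^(-n) (∑ √p_x)² =
2^(H_{1/2}(X) - n)`. Normalized, it is the required `σ_E` (`phaseEnvelope`,
`posSemidef_phaseEnvelope_sub`). The weights `√p_x` minimize the trace `2^(-n) (∑ w_x) (∑ p_x /
w_x)`.

For smoothing parameter zero the state itself is a candidate. A virtual scheme reduces to the
general case: `V.preState` is a semi-purification of the sifted state, because Eve's conditional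
states depend on Alice's measurement only through its positive operators
(`VirtualScheme.bitBlock_mul_conjTranspose`). -/

lemma star_dotProduct_mul_conjTranspose_mulVec {ε κ : Type*} [Fintype ε] [Fintype κ]
    (M : Matrix ε κ ℂ) (v : ε → ℂ) :
    star v ⬝ᵥ ((M * Mᴴ) *ᵥ v) = ((∑ k, ‖(Mᴴ *ᵥ v) k‖ ^ 2 : ℝ) : ℂ) := by
  rw [← mulVec_mulVec, dotProduct_mulVec]
  conv_lhs => rw [← conjTranspose_conjTranspose M, ← star_mulVec, conjTranspose_conjTranspose]
  simp [dotProduct, Complex.conj_mul']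

/-- A weighted Cauchy-Schwarz inequality in the Loewner order. -/
lemma posSemidef_sum_smul_sub_mul_conjTranspose {ι ε κ : Type*} [Fintype ι] [Fintype ε]
    [Fintype κ] (M : ι → Matrix ε κ ℂ) (c : ι → ℂ) (w : ι → ℝ) (hw : ∀ x, 0 ≤ w x)
    (hM : ∀ x, w x = 0 → M x = 0) :
    ((∑ x, w x) • (∑ x, ((w x)⁻¹ * ‖c x‖ ^ 2) • (M x * (M x)ᴴ)) -
      (∑ x, c x • M x) * (∑ x, c x • M x)ᴴ).PosSemidef := by
  have hH : (∑ x, ((w x)⁻¹ * ‖c x‖ ^ 2) • (M x * (M x)ᴴ)).PosSemidef :=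
    posSemidef_sum _ fun x _ => (posSemidef_self_mul_conjTranspose (M x)).smul
      (mul_nonneg (inv_nonneg.2 (hw x)) (sq_nonneg _))
  refine PosSemidef.of_dotProduct_mulVec_nonneg
    ((hH.smul (Finset.sum_nonneg fun x _ => hw x)).1.sub
      (posSemidef_self_mul_conjTranspose _).1) fun v => ?_
  rw [sub_mulVec, dotProduct_sub, star_dotProduct_mul_conjTranspose_mulVec, smul_mulVec,
    dotProduct_smul, sum_mulVec, dotProduct_sum]
  simp_rw [smul_mulVec, dotProduct_smul, star_dotProduct_mul_conjTranspose_mulVec,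
    Complex.real_smul, ← Complex.ofReal_mul, ← Complex.ofReal_sum, ← Complex.ofReal_mul,
    ← Complex.ofReal_sub]
  rw [Complex.zero_le_real, sub_nonneg]
  -- With the sum over `k` outermost, the claim splits into one scalar Cauchy-Schwarz inequality for
  -- each coordinate `k`.
  have hc : ∑ x, (w x)⁻¹ * ‖c x‖ ^ 2 * ∑ k, ‖((M x)ᴴ *ᵥ v) k‖ ^ 2 =
      ∑ k, ∑ x, (w x)⁻¹ * ‖c x‖ ^ 2 * ‖((M x)ᴴ *ᵥ v) k‖ ^ 2 := by
    simp_rw [Finset.mul_sum]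
    exact Finset.sum_comm
  rw [hc, Finset.mul_sum]
  refine Finset.sum_le_sum fun k _ => ?_
  have hk : ((∑ x, c x • M x)ᴴ *ᵥ v) k = ∑ x, star (c x) * ((M x)ᴴ *ᵥ v) k := by
    simp [conjTranspose_sum, sum_mulVec, smul_mulVec]
  rw [hk]
  calc ‖∑ x, star (c x) * ((M x)ᴴ *ᵥ v) k‖ ^ 2
      ≤ (∑ x, ‖c x‖ * ‖((M x)ᴴ *ᵥ v) k‖) ^ 2 := by
        gcongr
        refine (norm_sum_le _ _).trans_eq ?_
        simp
    _ ≤ _ := by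
        refine Finset.sum_sq_le_sum_mul_sum_of_sq_le_mul _ (fun x _ => hw x)
          (fun x _ => mul_nonneg (mul_nonneg (inv_nonneg.2 (hw x)) (sq_nonneg _)) (sq_nonneg _))
          fun x _ => le_of_eq ?_
        -- At `w x = 0` the inverse is `0`, so the identity needs `M x = 0`.
        by_cases h : w x = 0
        · simp [hM x h]
        · field_simp

/-! ### Signs and the phase basis. -/

lemma neg_one_pow_val_add (a b : ZMod 2) :
    (-1 : ℂ) ^ (a + b).val = (-1) ^ a.val * (-1) ^ b.val := by
  -- Over `ℤ` the finite check is decidable; the result is then cast to `ℂ`.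
  have key : ∀ a b : ZMod 2, (-1 : ℤ) ^ (a + b).val = (-1) ^ a.val * (-1) ^ b.val := by decide
  exact_mod_cast congrArg (Int.cast : ℤ → ℂ) (key a b)

lemma neg_one_pow_val_dotProduct {n : ℕ} (x z : BitString n) :
    (-1 : ℂ) ^ (x ⬝ᵥ z).val = ∏ i, (-1) ^ (x i * z i).val := by
  simp only [dotProduct]
  induction (Finset.univ : Finset (Fin n)) using Finset.induction_on with
  | empty => simp
  | insert i s hi ih => rw [Finset.sum_insert hi, Finset.prod_insert hi, neg_one_pow_val_add, ih]

/-- Character orthogonality: the sum factorizes over the bits, and a bit where `z` and `z'` differ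
contributes the factor zero. -/
lemma sum_neg_one_pow_dotProduct {n : ℕ} (z z' : BitString n) :
    ∑ x : BitString n, (-1 : ℂ) ^ (x ⬝ᵥ z).val * (-1) ^ (x ⬝ᵥ z').val =
      if z = z' then 2 ^ n else 0 := by
  have key : ∀ a b : ZMod 2, ∑ c : ZMod 2, (-1 : ℂ) ^ (c * a).val * (-1) ^ (c * b).val =
      if a = b then 2 else 0 := by
    have : ∀ a b : ZMod 2, ∑ c : ZMod 2, (-1 : ℤ) ^ (c * a).val * (-1) ^ (c * b).val =
      if a = b then 2 else 0 := by decide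
    intro a b
    exact_mod_cast congrArg (Int.cast : ℤ → ℂ) (this a b)
  simp_rw [neg_one_pow_val_dotProduct, ← Finset.prod_mul_distrib]
  rw [← Fintype.prod_sum (fun (i : Fin n) (c : ZMod 2) =>
    (-1 : ℂ) ^ (c * z i).val * (-1) ^ (c * z' i).val)]
  simp_rw [key]
  split_ifs with h
  · simp [h]
  · obtain ⟨i, hi⟩ := Function.ne_iff.1 h
    exact Finset.prod_eq_zero (Finset.mem_univ i) (if_neg hi)

/-- Real amplitudes are what allow `phaseBlock` to omit the conjugation of `⟨x̃|`. -/
lemma star_phaseKet {n : ℕ} (x : BitString n) : star (phaseKet x) = phaseKet x := by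
  ext z
  simp [phaseKet]

lemma norm_phaseKet_sq {n : ℕ} (x z : BitString n) : ‖phaseKet x z‖ ^ 2 = (2 : ℝ) ^ (-(n : ℝ)) := by
  simp only [phaseKet, norm_mul, norm_pow, norm_neg, norm_one, one_pow, mul_one,
    Complex.norm_real, Real.norm_eq_abs, sq_abs]
  rw [← Real.rpow_natCast, ← Real.rpow_mul (by norm_num)]
  congr 1
  push_cast
  ring

/-- The phase basis resolves the identity. -/
lemma sum_phaseKet_mul_phaseKet {n : ℕ} (z z' : BitString n) :
    ∑ x, phaseKet x z * phaseKet x z' = if z = z' then 1 else 0 := by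
  have h : ∀ x : BitString n, phaseKet x z * phaseKet x z' = (((2 : ℝ) ^ (-(n : ℝ)) : ℝ) : ℂ) *
      ((-1 : ℂ) ^ (x ⬝ᵥ z).val * (-1) ^ (x ⬝ᵥ z').val) := by
    intro x
    have : (2 : ℝ) ^ (-(n : ℝ)) = (2 : ℝ) ^ (-(n : ℝ) / 2) * (2 : ℝ) ^ (-(n : ℝ) / 2) := by
      rw [← Real.rpow_add (by norm_num)]
      congr 1
      ring
    rw [this]
    simp only [phaseKet]
    push_cast
    ring
  simp_rw [h]
  rw [← Finset.mul_sum, sum_neg_one_pow_dotProduct]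
  split_ifs
  · rw [Real.rpow_neg (by norm_num), Real.rpow_natCast]
    push_cast
    field_simp
  · simp

/-- The 1-norm term is `Tr ρ`, and the second term supplies the missing `1 - Tr ρ`. -/
lemma fidelity_self {α : Type*} [Fintype α] [DecidableEq α] {ρ : Matrix α α ℂ}
    (h : IsSubnormalized ρ) : fidelity ρ ρ = 1 := by
  have h0 : 0 ≤ ρ := h.1.nonneg
  have h1 : CFC.sqrt ρ * CFC.sqrt ρ = ρ := CFC.sqrt_mul_sqrt_self ρ h0
  have h2 : CFC.sqrt (ρᴴ * ρ) = ρ := by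
    rw [h.1.1.eq]
    exact CFC.sqrt_mul_self ρ h0
  rw [fidelity, norm1, h1, h2, Real.sqrt_mul_self (by linarith [h.2])]
  ring

lemma condMinEntropy_le_smoothCondMinEntropy_zero {α ε : Type*} [Fintype α] [DecidableEq α]
    [Fintype ε] [DecidableEq ε] {ρ : Matrix (α × ε) (α × ε) ℂ} (h : IsSubnormalized ρ) :
    condMinEntropy ρ ≤ smoothCondMinEntropy 0 ρ :=
  le_sSup ⟨ρ, rfl, h, by simp [purifiedDistance, fidelity_self h]⟩

/-! ### Block decompositions and the bound for semi-purifications. -/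

section
variable {n : ℕ} {ε κ : Type*}

/-- The component `⟨z|Φ` of a vector in `H_A ⊗ H_E ⊗ H_Ā`, as an operator from `H_Ā` to `H_E`. -/
def bitBlock (Φ : (BitString n × ε) × κ → ℂ) (z : BitString n) : Matrix ε κ ℂ :=
  Matrix.of fun e k => Φ ((z, e), k)

/-- The component `⟨x̃|Φ` of a vector in `H_A ⊗ H_E ⊗ H_Ā`, as an operator from `H_Ā` to `H_E`. -/
def phaseBlock (Φ : (BitString n × ε) × κ → ℂ) (x : BitString n) : Matrix ε κ ℂ :=
  Matrix.of fun e k => ∑ z, phaseKet x z * Φ ((z, e), k)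

lemma sum_phaseKet_smul_phaseBlock (Φ : (BitString n × ε) × κ → ℂ) (z : BitString n) :
    ∑ x, phaseKet x z • phaseBlock Φ x = bitBlock Φ z := by
  ext e k
  simp only [Matrix.sum_apply, Matrix.smul_apply, phaseBlock, bitBlock, of_apply, smul_eq_mul,
    Finset.mul_sum]
  rw [Finset.sum_comm]
  simp_rw [← mul_assoc, ← Finset.sum_mul, sum_phaseKet_mul_phaseKet]
  simp

variable [Fintype ε] [Fintype κ]

lemma trace_mul_conjTranspose_self (M : Matrix ε κ ℂ) :
    (M * Mᴴ).trace = ((∑ e, ∑ k, ‖M e k‖ ^ 2 : ℝ) : ℂ) := by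
  simp [trace, mul_apply, Complex.mul_conj']

/-- As a squared Hilbert-Schmidt norm, a vanishing probability forces its block to vanish, as the
weighted inequality requires. -/
lemma phaseDist_eq (Φ : (BitString n × ε) × κ → ℂ) (x : BitString n) :
    phaseDist Φ x = ∑ e, ∑ k, ‖phaseBlock Φ x e k‖ ^ 2 := by
  have h : star (phaseKet x) ⬝ᵥ (ptrace (ptrace (pureOp Φ))).mulVec (phaseKet x) =
      (phaseBlock Φ x * (phaseBlock Φ x)ᴴ).trace := by
    have hs : ∀ z, (starRingEnd ℂ) (phaseKet x z) = phaseKet x z := fun z =>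
      congrFun (star_phaseKet x) z
    simp only [dotProduct, mulVec, ptrace, pureOp, vecMulVec_apply, of_apply,
      trace, diag_apply, mul_apply, conjTranspose_apply, phaseBlock, Pi.star_apply, star_sum,
      star_mul', Finset.sum_mul, Finset.mul_sum, RCLike.star_def, hs]
    calc _ = ∑ z, ∑ e, ∑ z', ∑ k, phaseKet x z * (Φ ((z, e), k) *
          (starRingEnd ℂ) (Φ ((z', e), k)) * phaseKet x z') :=
          Finset.sum_congr rfl fun _ _ => Finset.sum_comm
      _ = ∑ e, ∑ z, ∑ k, ∑ z', phaseKet x z * (Φ ((z, e), k) *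
          (starRingEnd ℂ) (Φ ((z', e), k)) * phaseKet x z') := by
          rw [Finset.sum_comm]
          exact Finset.sum_congr rfl fun _ _ => Finset.sum_congr rfl fun _ _ => Finset.sum_comm
      _ = ∑ e, ∑ k, ∑ z, ∑ z', phaseKet x z * (Φ ((z, e), k) *
          (starRingEnd ℂ) (Φ ((z', e), k)) * phaseKet x z') :=
          Finset.sum_congr rfl fun _ _ => Finset.sum_comm
      _ = _ := by
          refine Finset.sum_congr rfl fun e _ => Finset.sum_congr rfl fun k _ => ?_
          rw [Finset.sum_comm]
          exact Finset.sum_congr rfl fun z _ => Finset.sum_congr rfl fun z' _ => by ring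
  rw [phaseDist, h, trace_mul_conjTranspose_self, Complex.ofReal_re]

lemma phaseDist_nonneg (Φ : (BitString n × ε) × κ → ℂ) (x : BitString n) :
    0 ≤ phaseDist Φ x := by
  rw [phaseDist_eq]
  positivity

lemma phaseBlock_eq_zero {Φ : (BitString n × ε) × κ → ℂ} {x : BitString n}
    (h : phaseDist Φ x = 0) : phaseBlock Φ x = 0 := by
  rw [← trace_mul_conjTranspose_self_eq_zero_iff, trace_mul_conjTranspose_self,
    ← phaseDist_eq, h, Complex.ofReal_zero]

variable [DecidableEq ε]

lemma zMeasure_apply (ρ : Matrix (BitString n × ε) (BitString n × ε) ℂ)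
    (i j : BitString n × ε) : zMeasure ρ i j = if i.1 = j.1 then ρ i j else 0 := by
  have hs : ∀ z : BitString n, (Matrix.single z z (1 : ℂ) ⊗ₖ (1 : Matrix ε ε ℂ)) =
      Matrix.diagonal fun p => if p.1 = z then 1 else 0 := by
    intro z
    rw [← Matrix.diagonal_single, ← Matrix.diagonal_one, diagonal_kronecker_diagonal]
    congr 1
    ext p
    simp [Pi.single_apply]
  simp only [zMeasure, hs, Matrix.sum_apply, mul_diagonal, diagonal_mul]
  split_ifs with h
  · simp [h]
  · refine Finset.sum_eq_zero fun z _ => ?_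
    by_cases hz : i.1 = z
    · subst hz
      simp [Ne.symm h]
    · simp [hz]

lemma zMeasure_ptrace_pureOp (Φ : (BitString n × ε) × κ → ℂ) :
    zMeasure (ptrace (pureOp Φ)) =
      ∑ z, Matrix.single z z (1 : ℂ) ⊗ₖ (bitBlock Φ z * (bitBlock Φ z)ᴴ) := by
  ext i j
  rw [zMeasure_apply]
  simp only [ptrace, pureOp, vecMulVec_apply, of_apply, Matrix.sum_apply, kroneckerMap_apply,
    mul_apply, conjTranspose_apply, bitBlock, Pi.star_apply, single_apply, ite_mul, one_mul,
    zero_mul]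
  obtain ⟨z, e⟩ := i
  obtain ⟨z', e'⟩ := j
  dsimp only
  split_ifs with h
  · subst h
    simp
  · refine (Finset.sum_eq_zero fun y _ => if_neg ?_).symm
    rintro ⟨rfl, rfl⟩
    exact h rfl

/-- The operator on `H_E` that bounds, up to a factor, a state whose semi-purification is `Φ`. -/
def phaseEnvelope (Φ : (BitString n × ε) × κ → ℂ) : Matrix ε ε ℂ :=
  (∑ x, √(phaseDist Φ x))⁻¹ •
    ∑ x, (√(phaseDist Φ x))⁻¹ • (phaseBlock Φ x * (phaseBlock Φ x)ᴴ)

omit [DecidableEq ε] in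
lemma isNormalized_phaseEnvelope {Φ : (BitString n × ε) × κ → ℂ}
    (h : ∑ x, √(phaseDist Φ x) ≠ 0) : IsNormalized (phaseEnvelope Φ) := by
  constructor
  · refine PosSemidef.smul (posSemidef_sum _ fun x _ =>
      (posSemidef_self_mul_conjTranspose _).smul ?_) ?_
    · positivity
    · exact inv_nonneg.2 (Finset.sum_nonneg fun x _ => Real.sqrt_nonneg _)
  · rw [phaseEnvelope, trace_smul, trace_sum]
    simp_rw [trace_smul, trace_mul_conjTranspose_self, ← phaseDist_eq, Complex.real_smul,
      ← Complex.ofReal_mul, ← Complex.ofReal_sum, ← Complex.ofReal_mul]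
    rw [← Complex.ofReal_one]
    congr 1
    -- This also holds at probability zero, where both sides are `0`.
    have : ∀ x, (√(phaseDist Φ x))⁻¹ * phaseDist Φ x = √(phaseDist Φ x) := fun x => by
      rw [mul_comm, ← div_eq_mul_inv, Real.div_sqrt]
    simp_rw [this]
    exact inv_mul_cancel₀ h

omit [DecidableEq ε] in
lemma posSemidef_phaseEnvelope_sub (Φ : (BitString n × ε) × κ → ℂ)
    (h : ∑ x, √(phaseDist Φ x) ≠ 0) (z : BitString n) :
    (((2 : ℝ) ^ (-(n : ℝ)) * (∑ x, √(phaseDist Φ x)) ^ 2) • phaseEnvelope Φ -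
      bitBlock Φ z * (bitBlock Φ z)ᴴ).PosSemidef := by
  have key := posSemidef_sum_smul_sub_mul_conjTranspose (phaseBlock Φ) (fun x => phaseKet x z)
    (fun x => √(phaseDist Φ x)) (fun x => Real.sqrt_nonneg _)
    (fun x hx => phaseBlock_eq_zero ((Real.sqrt_eq_zero (phaseDist_nonneg Φ x)).1 hx))
  rw [sum_phaseKet_smul_phaseBlock] at key
  convert key using 2
  have hc : ∑ x, ((√(phaseDist Φ x))⁻¹ * ‖phaseKet x z‖ ^ 2) •
      (phaseBlock Φ x * (phaseBlock Φ x)ᴴ) = (2 : ℝ) ^ (-(n : ℝ)) •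
      ∑ x, (√(phaseDist Φ x))⁻¹ • (phaseBlock Φ x * (phaseBlock Φ x)ᴴ) := by
    simp_rw [Finset.smul_sum, norm_phaseKet_sq, mul_comm _ ((2 : ℝ) ^ (-(n : ℝ))), smul_smul]
  rw [phaseEnvelope, hc, smul_smul, smul_smul]
  congr 1
  field_simp

-- Since `1 = ∑ |z⟩⟨z|`, the difference is a direct sum of the blocks `σ - ρ z`.
omit [DecidableEq ε] in
lemma posSemidef_one_kronecker_sub {α : Type*} [Fintype α] [DecidableEq α] (σ : Matrix ε ε ℂ)
    (ρ : α → Matrix ε ε ℂ) (h : ∀ z, (σ - ρ z).PosSemidef) :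
    ((1 : Matrix α α ℂ) ⊗ₖ σ - ∑ z, Matrix.single z z (1 : ℂ) ⊗ₖ ρ z).PosSemidef := by
  have h1 : (1 : Matrix α α ℂ) ⊗ₖ σ - ∑ z, Matrix.single z z (1 : ℂ) ⊗ₖ ρ z =
      ∑ z, Matrix.single z z (1 : ℂ) ⊗ₖ (σ - ρ z) := by
    ext i j
    simp only [Matrix.sub_apply, Matrix.sum_apply, kroneckerMap_apply, mul_sub,
      Finset.sum_sub_distrib, ← Finset.sum_mul]
    congr 2
    rw [← Matrix.sum_single_one, Matrix.sum_apply]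
  rw [h1]
  refine posSemidef_sum _ fun z _ => PosSemidef.kronecker ?_ (h z)
  rw [← Matrix.diagonal_single]
  exact PosSemidef.diagonal (Pi.single_nonneg.2 zero_le_one)

lemma exists_isNormalized [Nonempty ε] : ∃ σ : Matrix ε ε ℂ, IsNormalized σ := by
  obtain ⟨e⟩ := ‹Nonempty ε›
  refine ⟨Matrix.single e e 1, ?_, by simp⟩
  rw [← Matrix.diagonal_single]
  exact PosSemidef.diagonal (Pi.single_nonneg.2 zero_le_one)

lemma trace_ptrace {α β : Type*} [Fintype α] [Fintype β] (M : Matrix (α × β) (α × β) ℂ) :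
    (ptrace M).trace = M.trace := by
  simp [trace, ptrace, Fintype.sum_prod_type]

lemma trace_zMeasure (ρ : Matrix (BitString n × ε) (BitString n × ε) ℂ) :
    (zMeasure ρ).trace = ρ.trace := by
  simp [trace, zMeasure_apply]

lemma IsSemiPurification.isSubnormalized {Φ : (BitString n × ε) × κ → ℂ}
    {ρ : Matrix (BitString n × ε) (BitString n × ε) ℂ} (h : IsSemiPurification Φ ρ) :
    IsSubnormalized ρ := by
  obtain ⟨h1, rfl⟩ := h
  refine ⟨?_, by rw [trace_zMeasure, trace_ptrace]; exact h1.2⟩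
  rw [zMeasure_ptrace_pureOp]
  refine posSemidef_sum _ fun z _ => PosSemidef.kronecker ?_ (posSemidef_self_mul_conjTranspose _)
  rw [← Matrix.diagonal_single]
  exact PosSemidef.diagonal (Pi.single_nonneg.2 zero_le_one)

lemma IsSemiPurification.le_condMinEntropy [Nonempty ε] {Φ : (BitString n × ε) × κ → ℂ}
    {ρ : Matrix (BitString n × ε) (BitString n × ε) ℂ} {Hth : ℝ} (h : IsSemiPurification Φ ρ)
    (hX : AssumptionSMPECRenyi Φ Hth) : (((n : ℝ) - Hth : ℝ) : EReal) ≤ condMinEntropy ρ := by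
  obtain ⟨-, rfl⟩ := h
  rw [zMeasure_ptrace_pureOp]
  -- In the zero case `H_{1/2}(X)` is `⊥` and gives no information, but the state vanishes and any
  -- normalized `σ` serves.
  by_cases hs : ∑ x, √(phaseDist Φ x) = 0
  · obtain ⟨σ, hσ⟩ := exists_isNormalized (ε := ε)
    have hz : ∀ z, bitBlock Φ z = 0 := fun z => by
      rw [← sum_phaseKet_smul_phaseBlock]
      refine Finset.sum_eq_zero fun x _ => ?_
      rw [phaseBlock_eq_zero ((Real.sqrt_eq_zero (phaseDist_nonneg Φ x)).1
        ((Finset.sum_eq_zero_iff_of_nonneg fun x _ => Real.sqrt_nonneg _).1 hs x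
          (Finset.mem_univ x))), smul_zero]
    refine le_sSup ⟨_, rfl, σ, hσ, ?_⟩
    simp only [hz, Matrix.zero_mul, kronecker_zero, Finset.sum_const_zero, sub_zero]
    exact (PosSemidef.one.kronecker hσ.1).smul (Real.rpow_nonneg zero_le_two _)
  · have hpos : 0 < ∑ x, √(phaseDist Φ x) :=
      lt_of_le_of_ne (Finset.sum_nonneg fun x _ => Real.sqrt_nonneg _) (Ne.symm hs)
    have hnorm := isNormalized_phaseEnvelope hs
    refine le_sSup ⟨_, rfl, phaseEnvelope Φ, hnorm, ?_⟩
    rw [← kronecker_smul]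
    refine posSemidef_one_kronecker_sub _ _ fun z => ?_
    rw [AssumptionSMPECRenyi, renyiHalf, if_neg hs, EReal.coe_le_coe_iff] at hX
    -- Exponentiating the entropy bound gives `(∑ √p_x)² ≤ 2^Hth`.
    have hle : (2 : ℝ) ^ (-(n : ℝ)) * (∑ x, √(phaseDist Φ x)) ^ 2 ≤ (2 : ℝ) ^ (-((n : ℝ) - Hth)) := by
      rw [neg_sub, sub_eq_neg_add, Real.rpow_add two_pos]
      gcongr
      have := Real.rpow_le_rpow_of_exponent_le one_le_two hX
      rwa [mul_comm 2, Real.rpow_mul two_pos.le, Real.rpow_logb two_pos (by norm_num) hpos,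
        Real.rpow_two] at this
    have := (hnorm.1.smul (sub_nonneg.2 hle)).add (posSemidef_phaseEnvelope_sub Φ hs z)
    rwa [sub_smul, sub_add_sub_cancel] at this

lemma IsSemiPurification.assumptionSMLHL [Nonempty ε] {Φ : (BitString n × ε) × κ → ℂ}
    {ρ : Matrix (BitString n × ε) (BitString n × ε) ℂ} {Hth : ℝ} (h : IsSemiPurification Φ ρ)
    (hX : AssumptionSMPECRenyi Φ Hth) : AssumptionSMLHL ρ 0 ((n : ℝ) - Hth) :=
  (h.le_condMinEntropy hX).trans (condMinEntropy_le_smoothCondMinEntropy_zero h.isSubnormalized)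

end

/-! ### Partial traces and slices along Eve's system. -/

lemma ptrace_pureOp {α β : Type*} [Fintype β] (ψ : α × β → ℂ) :
    ptrace (pureOp ψ) =
      (Matrix.of fun x k => ψ (x, k) : Matrix α β ℂ) * (Matrix.of fun x k => ψ (x, k))ᴴ := by
  ext i j
  simp [ptrace, pureOp, vecMulVec_apply, mul_apply]

/-- An ancilla prepared in a basis state selects the corresponding columns of `Q`. -/
lemma mul_kronecker_single_mul_conjTranspose {α β γ : Type*} [Fintype α] [Fintype β]
    [DecidableEq β] (Q : Matrix γ (α × β) ℂ) (ρ : Matrix α α ℂ) (b : β) :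
    Q * (ρ ⊗ₖ Matrix.single b b (1 : ℂ)) * Qᴴ =
      Q.submatrix id (fun x => (x, b)) * ρ * (Q.submatrix id fun x => (x, b))ᴴ := by
  ext i j
  simp [mul_apply, Fintype.sum_prod_type, single_apply, ite_and, Finset.sum_mul]

section Slices

variable {A E B ι κ : Type*} [Fintype A] [Fintype E] [DecidableEq E] [Fintype B]

lemma kronecker_one_kronecker_mul_submatrix (F : Matrix A A ℂ) (H : Matrix B B ℂ)
    (M : Matrix (A × E × B) ι ℂ) (e : E) (g : κ → ι) :
    ((F ⊗ₖ ((1 : Matrix E E ℂ) ⊗ₖ H)) * M).submatrix (fun p : A × B => (p.1, e, p.2)) g =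
      (F ⊗ₖ H) * M.submatrix (fun p : A × B => (p.1, e, p.2)) g := by
  ext p k
  simp only [submatrix_apply, mul_apply, Fintype.sum_prod_type, kroneckerMap_apply]
  refine Finset.sum_congr rfl fun a _ => ?_
  rw [Finset.sum_eq_single e]
  · simp
  · intro f _ hf
    simp [one_apply_ne (Ne.symm hf)]
  · simp

lemma mul_kronecker_one_kronecker_submatrix (F : Matrix A A ℂ) (H : Matrix B B ℂ)
    (M : Matrix ι (A × E × B) ℂ) (e : E) (g : κ → ι) :
    (M * (F ⊗ₖ ((1 : Matrix E E ℂ) ⊗ₖ H))ᴴ).submatrix g (fun p : A × B => (p.1, e, p.2)) =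
      M.submatrix g (fun p : A × B => (p.1, e, p.2)) * (F ⊗ₖ H)ᴴ := by
  have h := congrArg conjTranspose (kronecker_one_kronecker_mul_submatrix F H Mᴴ e g)
  simpa only [conjTranspose_submatrix, conjTranspose_mul, conjTranspose_conjTranspose] using h

/-- Operators trivial on `E` act on each slice separately, so cyclicity of the trace leaves only `Fᴴ
* F` and `Hᴴ * H`. -/
lemma trace_slice_conj (F : Matrix A A ℂ) (H : Matrix B B ℂ)
    (M : Matrix (A × E × B) (A × E × B) ℂ) (e e' : E) :
    (((F ⊗ₖ ((1 : Matrix E E ℂ) ⊗ₖ H)) * M * (F ⊗ₖ ((1 : Matrix E E ℂ) ⊗ₖ H))ᴴ).submatrix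
      (fun p : A × B => (p.1, e, p.2)) (fun p : A × B => (p.1, e', p.2))).trace =
    (((Fᴴ * F) ⊗ₖ (Hᴴ * H)) *
      M.submatrix (fun p : A × B => (p.1, e, p.2)) (fun p : A × B => (p.1, e', p.2))).trace := by
  rw [Matrix.mul_assoc, kronecker_one_kronecker_mul_submatrix,
    mul_kronecker_one_kronecker_submatrix, ← Matrix.mul_assoc, trace_mul_comm, ← Matrix.mul_assoc,
    conjTranspose_kronecker, ← mul_kronecker_mul]

end Slices

/-! ### The sifted key in the actual and virtual schemes. -/

section Schemes

variable {n : ℕ} {A E B I C R : Type*} [Fintype A] [DecidableEq A] [Fintype E] [DecidableEq E]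
  [Fintype B] [DecidableEq B] [Fintype I] [Fintype C] [DecidableEq C] [Fintype R] [DecidableEq R]

lemma ActualScheme.trace_sample_le (S : ActualScheme n A E B I) :
    (S.sample S.init).trace.re ≤ 1 := by
  have h1 : ∀ i, 0 ≤ (S.smp i * S.init * (S.smp i)ᴴ).trace.re := fun i =>
    (Complex.le_def.1 (S.init_normalized.1.mul_mul_conjTranspose_same (S.smp i)).trace_nonneg).1
  have h2 : ∑ i, (S.smp i * S.init * (S.smp i)ᴴ).trace = 1 := by
    have h : ∀ i, (S.smp i * S.init * (S.smp i)ᴴ).trace =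
        ((S.smp i)ᴴ * S.smp i * S.init).trace := fun i => Matrix.trace_mul_cycle _ _ _
    simp_rw [h]
    rw [← trace_sum, ← Finset.sum_mul, S.smp_complete, Matrix.one_mul, S.init_normalized.2]
  calc (S.sample S.init).trace.re = ∑ i ∈ S.pass, (S.smp i * S.init * (S.smp i)ᴴ).trace.re := by
        rw [ActualScheme.sample, trace_sum, Complex.re_sum]
    _ ≤ ∑ i, (S.smp i * S.init * (S.smp i)ᴴ).trace.re :=
        Finset.sum_le_sum_of_subset_of_nonneg (Finset.subset_univ _) fun i _ _ => h1 i
    _ = 1 := by rw [← Complex.re_sum, h2, Complex.one_re]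

/-- Eve's unnormalized state, conditioned on Alice's sifted key `z`. -/
def ActualScheme.siftedBlock (S : ActualScheme n A E B I) (z : BitString n) : Matrix E E ℂ :=
  Matrix.of fun e e' => ((((S.sifA z)ᴴ * S.sifA z) ⊗ₖ (1 : Matrix B B ℂ)) *
    (S.sample S.init).submatrix (fun p : A × B => (p.1, e, p.2))
      (fun p : A × B => (p.1, e', p.2))).trace

lemma ActualScheme.siftedAE_eq (S : ActualScheme n A E B I) :
    S.siftedAE = ∑ z, Matrix.single z z (1 : ℂ) ⊗ₖ S.siftedBlock z := by
  have hB : ∀ (z : BitString n) (e e' : E), S.siftedBlock z e e' =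
      ∑ b, ∑ a' : A, ∑ b' : B, ((S.sifA z ⊗ₖ ((1 : Matrix E E ℂ) ⊗ₖ S.sifB b)) *
        S.sample S.init * (S.sifA z ⊗ₖ ((1 : Matrix E E ℂ) ⊗ₖ S.sifB b))ᴴ)
          (a', e, b') (a', e', b') := by
    intro z e e'
    have h := fun b => trace_slice_conj (S.sifA z) (S.sifB b) (S.sample S.init) e e'
    simp_rw [trace, diag_apply, submatrix_apply, Fintype.sum_prod_type] at h
    simp_rw [h]
    -- Completeness of Bob's measurement makes it disappear once his outcome is discarded.
    have hk : ((S.sifA z)ᴴ * S.sifA z) ⊗ₖ (1 : Matrix B B ℂ) =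
        ∑ b, ((S.sifA z)ᴴ * S.sifA z) ⊗ₖ ((S.sifB b)ᴴ * S.sifB b) := by
      rw [← S.sifB_complete]
      ext p q
      simp [Matrix.sum_apply, kroneckerMap_apply, Finset.mul_sum]
    simp only [siftedBlock, of_apply, hk, Finset.sum_mul, trace_sum]
    simp only [trace, diag_apply, Fintype.sum_prod_type]
  ext ⟨z, e⟩ ⟨z', e'⟩
  simp only [ActualScheme.siftedAE, ActualScheme.sifted, of_apply, Matrix.sum_apply,
    kroneckerMap_apply, hB]
  by_cases h : z = z'
  · subst h
    simp [single_apply]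
  · have hz : ∀ y : BitString n, Matrix.single y y (1 : ℂ) z z' = 0 := fun y =>
      single_apply_of_ne _ _ _ _ _ (by rintro ⟨rfl, rfl⟩; exact h rfl)
    simp [hz]

lemma ActualScheme.trace_siftedAE (S : ActualScheme n A E B I) :
    S.siftedAE.trace = (S.sample S.init).trace := by
  have h1 : ∀ e, ∑ z, S.siftedBlock z e e = ∑ a : A, ∑ b : B,
      S.sample S.init (a, e, b) (a, e, b) := by
    intro e
    simp only [siftedBlock, of_apply]
    rw [← trace_sum, ← Finset.sum_mul]
    have : ∑ z, ((S.sifA z)ᴴ * S.sifA z) ⊗ₖ (1 : Matrix B B ℂ) = 1 := by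
      rw [← one_kronecker_one (m := A), ← S.sifA_complete]
      ext p q
      simp [Matrix.sum_apply, kroneckerMap_apply, Finset.sum_mul]
    rw [this, Matrix.one_mul]
    simp [trace, Fintype.sum_prod_type]
  rw [S.siftedAE_eq, trace_sum]
  simp_rw [trace_kronecker, trace_single_eq_same, one_mul]
  simp only [trace, diag_apply]
  rw [Finset.sum_comm]
  simp_rw [h1, Fintype.sum_prod_type]
  exact Finset.sum_comm

variable {S : ActualScheme n A E B I} (V : VirtualScheme S C R)

/-- Both sides are the `smp_eq` map applied to the initial state: the inner trace removes the
purifying space `C`, the outer one the ancilla `R`. -/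
lemma VirtualScheme.ptrace_smpState :
    ptrace (ptrace (pureOp V.smpState)) = S.sample S.init := by
  rw [← V.smp_eq, ← V.ini_purifies, ptrace_pureOp V.smpState, ptrace_pureOp V.ini,
    mul_kronecker_single_mul_conjTranspose]
  have h : (Matrix.of fun y c => V.smpState (y, c) : Matrix ((A × E × B) × R) C ℂ) =
      (((1 : Matrix (A × E × B) (A × E × B) ℂ) ⊗ₖ V.pSmp) * V.uSmp).submatrix id
        (fun x => (x, V.blank)) * (Matrix.of fun x c => V.ini (x, c)) := by
    ext y c
    simp only [VirtualScheme.smpState, of_apply, mul_apply (N := Matrix.of _), submatrix_apply,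
      id_eq]
  rw [h, conjTranspose_mul]
  simp only [Matrix.mul_assoc]

/-- The state after the sample measurement, as an operator from Eve's space to Alice's ancilla. -/
def VirtualScheme.smpOp : Matrix (A × B × R × C) E ℂ :=
  Matrix.of fun k e => V.smpState (((k.1, e, k.2.1), k.2.2.1), k.2.2.2)

lemma VirtualScheme.bitBlock_preState (z : BitString n) :
    bitBlock V.preState z =
      (V.uSif.submatrix (fun k => (z, k)) (fun k => (0, k)) * V.smpOp)ᵀ := by
  ext e k
  simp [bitBlock, VirtualScheme.preState, VirtualScheme.smpOp, mul_apply]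

lemma VirtualScheme.bitBlock_mul_conjTranspose (z : BitString n) :
    bitBlock V.preState z * (bitBlock V.preState z)ᴴ = S.siftedBlock z := by
  -- In this form the unitary enters only through the product that `sif_eq` identifies with Alice's
  -- positive operator.
  have ht : ∀ M : Matrix (A × B × R × C) E ℂ, Mᵀ * Mᵀᴴ = (Mᴴ * M)ᵀ := fun M => by
    rw [transpose_mul]
    rfl
  rw [V.bitBlock_preState, ht, conjTranspose_mul, Matrix.mul_assoc, ← Matrix.mul_assoc _ _ V.smpOp,
    V.sif_eq]
  ext e e'
  simp only [ActualScheme.siftedBlock, ← V.ptrace_smpState, of_apply, transpose_apply, VirtualScheme.smpOp, mul_apply,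
    conjTranspose_apply, trace, diag_apply, submatrix_apply, kroneckerMap_apply, ptrace, pureOp,
    vecMulVec_apply, Pi.star_apply]
  rw [Fintype.sum_prod_type, Fintype.sum_prod_type]
  refine Finset.sum_congr rfl fun a _ => ?_
  rw [Fintype.sum_prod_type]
  refine Finset.sum_congr rfl fun b _ => ?_
  simp only [Fintype.sum_prod_type (α₁ := A), one_apply, mul_ite, ite_mul, mul_one, mul_zero,
    zero_mul, Finset.sum_ite_eq, Finset.mem_univ, if_true, Finset.mul_sum]
  rw [Finset.sum_comm]
  refine Finset.sum_congr rfl fun a' _ => ?_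
  rw [Fintype.sum_prod_type, Finset.sum_eq_single b (fun x _ hx => by simp [Ne.symm hx]) (by simp)]
  simp only [if_true]
  exact Finset.sum_congr rfl fun r _ => Finset.sum_congr rfl fun c _ => by ring

lemma VirtualScheme.isSemiPurification_preState :
    IsSemiPurification V.preState S.siftedAE := by
  have h : zMeasure (ptrace (pureOp V.preState)) = S.siftedAE := by
    simp_rw [zMeasure_ptrace_pureOp, V.bitBlock_mul_conjTranspose, S.siftedAE_eq]
  refine ⟨⟨posSemidef_vecMulVec_self_star _, ?_⟩, h⟩
  -- Partial trace and bit measurement preserve the trace, so the bound is inherited from the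
  -- sampled state.
  rw [← trace_ptrace, ← trace_zMeasure, h, S.trace_siftedAE]
  exact S.trace_sample_le

/-- An empty index type would force the trace of the initial state to be zero. -/
lemma ActualScheme.nonempty (S : ActualScheme n A E B I) : Nonempty E := by
  by_contra h
  rw [not_nonempty_iff] at h
  have := S.init_normalized.2
  simp [trace] at this

end Schemes

end QKD

end

theorem mainTheorem6 (n : ℕ) (Hth : ℝ) :
    -- every semi-purification of every sub-normalized classical-quantum state
    (∀ {E K : Type*} [Fintype E] [DecidableEq E] [Nonempty E] [Fintype K]
        (ρ : Matrix (QKD.BitString n × E) (QKD.BitString n × E) ℂ)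
        (Φ : (QKD.BitString n × E) × K → ℂ),
      QKD.IsSemiPurification Φ ρ → QKD.AssumptionSMPECRenyi Φ Hth →
        (((n : ℝ) - Hth : ℝ) : EReal) ≤ QKD.condMinEntropy ρ ∧
          QKD.AssumptionSMLHL ρ 0 ((n : ℝ) - Hth)) ∧
    -- the sifted-key state of every scheme, and the state of every associated virtual scheme
    (∀ {A E B I C R : Type*} [Fintype A] [DecidableEq A] [Fintype E] [DecidableEq E]
        [Fintype B] [DecidableEq B] [Fintype I] [Fintype C] [DecidableEq C]
        [Fintype R] [DecidableEq R]
        (S : QKD.ActualScheme n A E B I) (V : QKD.VirtualScheme S C R),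
      QKD.AssumptionSMPECRenyi V.preState Hth →
        (((n : ℝ) - Hth : ℝ) : EReal) ≤ QKD.condMinEntropy S.siftedAE ∧
          QKD.AssumptionSMLHL S.siftedAE 0 ((n : ℝ) - Hth)) := by
  refine ⟨fun ρ Φ hΦ hX => ⟨hΦ.le_condMinEntropy hX, hΦ.assumptionSMLHL hX⟩, fun S V hX => ?_⟩
  have := S.nonempty
  exact ⟨V.isSemiPurification_preState.le_condMinEntropy hX,
    V.isSemiPurification_preState.assumptionSMLHL hX⟩
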